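/- A Stirling permutation of order $k$ is a permutation $w_1\cdots w_{2k}$ of the multiset $\{1,1,2,2,\dots,k,k\}$ such that, for each $i$, every entry between the two occurrences of $i$ is greater than $i$. A Stirling permutation of the second kind of order $n$ is a sequence $\sigma$ of nonempty words, called the cycles of $\sigma$, whose entries together form the multiset $\{1,1,2,2,\dots,n,n\}$, such that: (i) for each $i\in[n]$ the two copies of $i$ lie in the same cycle; (ii) each cycle begins with its smallest entry, and the cycles are listed in increasing order of their smallest entries; (iii) for each cycle $(c_1,\dots,c_{2k})$, the word obtained from $c_1\cdots c_{2k}$ by replacing, for each $i$, its $i$-th smallest distinct value by $i$ is a Stirling permutation of order $k$. (Two such objects are equal only if they coincide as sequences of words.) A fixed point of $\sigma$ is a $k\in[n]$ such that $(k,k)$ is a cycle of $\sigma$, and $\mathcal{DQ}_n$ denotes the set of those $\sigma$ of order $n$ with no fixed points (Stirling derangements). Let $\mathrm{cap}(\sigma)$ be the number of cycle ascent plateaus of $\sigma$, that is, the total number, over all cycles $(c_1,\dots,c_{2k})$ of $\sigma$, of indices $2\le i\le 2k-1$ with $c_{i-1}<c_i=c_{i+1}$. There is a unique sequence $(h_n)_{n\ge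 0}$ of complex numbers such that, for all complex $z$ in a neighbourhood of $0$, $$\sqrt{\sec(2\mathrm{i}z)}=\sum_{n\ge 0}(-1)^n h_n\frac{z^{2n}}{(2n)!},$$ where $\mathrm{i}^2=-1$ and $\sqrt{\cdot}$ is the principal branch. With these numbers $h_n$, for every $n\ge 1$, $$\sum_{\sigma\in\mathcal{DQ}_n}(-1)^{\mathrm{cap}(\sigma)}=\begin{cases}0,&\text{if } n \text{ is odd},\\ (-1)^k h_k,&\text{if } n=2k.\end{cases}$$ -/

import Mathlib

/-- The multiset `{1, 1, 2, 2, …, n, n}`. -/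
def doubled (n : ℕ) : Multiset ℕ := 2 • (Finset.Icc 1 n).val

/-- `w` is a Stirling permutation of order `n`: a permutation of `{1, 1, …, n, n}` in which every
entry between the two occurrences of `a` is greater than `a`.
(`List.Sublist`, written `<+`, is the relation of being a not necessarily contiguous subsequence.) -/
def IsStirlingPerm (n : ℕ) (w : List ℕ) : Prop :=
  (w : Multiset ℕ) = doubled n ∧ ∀ a ∈ w, ∀ b ∈ w, List.Sublist [a, b, a] w → a < b

/-- The reduction of a word: every occurrence of its `i`-th smallest (distinct) entry is
replaced by `i`. -/
def red (w : List ℕ) : List ℕ := w.map fun a => (w.toFinset.filter (· ≤ a)).card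

/-- `σ`, a list of cycles, each cycle being given as the word of its entries, is (the standard
cycle form of) a Stirling permutation of the second kind of order `n`. -/
structure IsStirlingSecond (n : ℕ) (σ : List (List ℕ)) : Prop where
  /-- All entries together form the multiset `{1, 1, …, n, n}`. -/
  entries : (σ.flatten : Multiset ℕ) = doubled n
  /-- Cycles are nonempty. -/
  cycle_ne_nil : ∀ c ∈ σ, c ≠ []
  /-- The two copies of each `i` lie in the same cycle. -/
  same_cycle : ∀ i ∈ Finset.Icc 1 n, ∃ c ∈ σ, c.count i = 2
  /-- Each cycle starts with its smallest entry. -/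
  head_min : ∀ c ∈ σ, ∀ x ∈ c, c.headI ≤ x
  /-- The cycles are in increasing order of their smallest entries. -/
  sorted : σ.Pairwise fun c d => c.headI < d.headI
  /-- The reduction of each cycle, of length `2 * k`, is a Stirling permutation of order `k`. -/
  stirling : ∀ c ∈ σ, Even c.length ∧ IsStirlingPerm (c.length / 2) (red c)

/-- `σ` is a Stirling derangement of order `n`: a Stirling permutation of the second kind
for which no `(k k)` is a cycle. -/
def IsStirlingDerangement (n : ℕ) (σ : List (List ℕ)) : Prop :=
  IsStirlingSecond n σ ∧ ∀ k ∈ Finset.Icc 1 n, [k, k] ∉ σ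

/-- The number of ascent plateaus of a word `c₁ c₂ ⋯ cₘ`: the number of `i` with `2 ≤ i ≤ m - 1`
and `cᵢ₋₁ < cᵢ = cᵢ₊₁`. -/
def wordCap (c : List ℕ) : ℕ :=
  ((Finset.Icc 2 (c.length - 1)).filter fun i =>
    -- list positions are counted from `0`, so the `i`-th entry is at position `i - 1`
    c.getD (i - 2) 0 < c.getD (i - 1) 0 ∧ c.getD (i - 1) 0 = c.getD i 0).card

/-- The number of cycle ascent plateaus of `σ`. -/
def cap (σ : List (List ℕ)) : ℕ := (σ.map wordCap).sum

theorem finite_isStirlingDerangement (n : ℕ) : {σ | IsStirlingDerangement n σ}.Finite := by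
  have h1 : {w : List ℕ | (w : Multiset ℕ) = doubled n}.Finite := by
    obtain ⟨l, hl⟩ := Quot.exists_rep (doubled n)
    refine (l.permutations.toFinset.finite_toSet).subset ?_
    intro w hw
    have hw' : (w : Multiset ℕ) = (l : Multiset ℕ) := by
      rw [Set.mem_ofPred_eq] at hw
      rw [hw]
      exact hl.symm
    simpa using Multiset.coe_eq_coe.1 hw'
  have h2 : (Set.range fun c : Composition (2 * n) => c.blocks).Finite := Set.finite_range _
  refine Set.Finite.of_finite_image
    (f := fun σ : List (List ℕ) => (σ.flatten, σ.map List.length)) ((h1.prod h2).subset ?_) ?_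
  · rintro _ ⟨σ, hσ, rfl⟩
    refine ⟨hσ.1.entries, ⟨⟨σ.map List.length, ?_, ?_⟩, rfl⟩⟩
    · intro i hi
      obtain ⟨c, hc, rfl⟩ := List.mem_map.1 hi
      exact List.length_pos_of_ne_nil (hσ.1.cycle_ne_nil c hc)
    · have := congrArg Multiset.card hσ.1.entries
      simpa [doubled, List.length_flatten] using this
  · intro σ _ τ _ h
    simp only [Prod.mk.injEq] at h
    exact List.eq_iff_flatten_eq.2 h

/-- The set of Stirling derangements of order `n`. -/
noncomputable def stirlingDerangements (n : ℕ) : Finset (List (List ℕ)) :=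
  (finite_isStirlingDerangement n).toFinset

/-- The complex secant. -/
noncomputable def Complex.sec (z : ℂ) : ℂ := 1 / Complex.cos z

/-- `h` is the coefficient sequence in the expansion
`√(sec (2 i z)) = ∑ₙ (-1)ⁿ hₙ z²ⁿ / (2n)!`, valid for all complex `z` near `0`
(where `√` is the principal branch, so that the left-hand side is `1` at `z = 0`). -/
def IsSqrtSecCoeff (h : ℕ → ℂ) : Prop :=
  ∀ᶠ z in nhds (0 : ℂ),
    HasSum (fun n : ℕ => (-1) ^ n * h n * z ^ (2 * n) / ((2 * n).factorial : ℂ))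
      (Complex.sqrt (Complex.sec (2 * Complex.I * z)))

/-! Give a fixed point the weight `X` and every other cycle of length `2k` with `p` ascent plateaus
the weight `(X - 1)^p (X + 1)^(k - p)`. Let `P_n` (`weightPoly n`) be the sum over all `σ` of order
`n` of the product of the cycle weights. At `X = 0` a fixed point contributes `0` and a plateau
`-1`, so `P_n(0)` is the signed sum over Stirling derangements.

Every object of order `n + 1` arises exactly once from one of order `n`: put the adjacent pair `n+1,
n+1` after an entry of a cycle, or append it as a new last cycle. In a cycle with `p` plateaus, `2p`
of the `2k` positions destroy one plateau while creating another, and the rest create one. Insertion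
into a cycle therefore acts on its weight as `2 (X² - 1) d/dX` (`sum_cycleWeight_wordInsertions`),
and the product rule gives `P_{n+1} = X P_n + 2 (X² - 1) P_n'` (`weightPoly_succ`).

On the analytic side let `f(z) = √sec(2iz)` and `T(z) = i tan(2iz)`. Then `f' = T f` and `T' = 2 (T²
- 1)`, so the same recurrence yields `f^(n) = P_n(T) f` near `0` (`iteratedDeriv_sqrt_sec`). Since
`T(0) = 0` and `f(0) = 1`, the Taylor data of `f` are the numbers `P_n(0)`. They vanish for odd `n`
because `P_n` has the parity of `n`. -/

open Polynomial

/-! ### Ascent plateaus under insertion of a doubled largest letter -/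

/-- The number of ascent plateaus of a word, by recursion on the word. -/
def plateaus : List ℕ → ℕ
  | a :: b :: c :: l => (if a < b ∧ b = c then 1 else 0) + plateaus (b :: c :: l)
  | _ => 0

/-- All words obtained from `w` by inserting `m m` directly after one of its entries. -/
def wordInsertions (m : ℕ) : List ℕ → List (List ℕ)
  | [] => []
  | a :: l => (a :: m :: m :: l) :: (wordInsertions m l).map (a :: ·)

/-- All lists of cycles obtained from `σ` by inserting `m m` into one of the cycles, or by
appending the cycle `(m m)`. -/
def cycleInsertions (m : ℕ) : List (List ℕ) → List (List (List ℕ))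
  | [] => [[[m, m]]]
  | c :: σ => (wordInsertions m c).map (· :: σ) ++ (cycleInsertions m σ).map (c :: ·)

theorem wordCap_cons (a b c : ℕ) (l : List ℕ) :
    wordCap (a :: b :: c :: l) =
      (if a < b ∧ b = c then 1 else 0) + wordCap (b :: c :: l) := by
  -- With positions counted from `0`, the test on the first three letters is the term `i = 0`, which
  -- can be split off.
  have key : ∀ w : List ℕ, wordCap w = ∑ i ∈ Finset.range (w.length - 2),
      if w.getD i 0 < w.getD (i + 1) 0 ∧ w.getD (i + 1) 0 = w.getD (i + 2) 0 then 1 else 0 := by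
    intro w
    rw [wordCap, Finset.card_filter, ← Finset.Ico_add_one_right_eq_Icc,
      Finset.sum_Ico_eq_sum_range]
    rw [show w.length - 1 + 1 - 2 = w.length - 2 by omega]
    refine Finset.sum_congr rfl fun i _ => ?_
    rw [show 2 + i - 2 = i by omega, show 2 + i - 1 = i + 1 by omega, Nat.add_comm 2 i]
  rw [key, key]
  simp only [List.length_cons]
  rw [show l.length + 1 + 1 + 1 - 2 = l.length + 1 by omega,
    show l.length + 1 + 1 - 2 = l.length by omega, Finset.sum_range_succ', add_comm]
  simp

theorem wordCap_eq_plateaus : ∀ w : List ℕ, wordCap w = plateaus w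
  | [] => by simp [wordCap, plateaus]
  | [_] => by simp [wordCap, plateaus]
  | [_, _] => by simp [wordCap, plateaus]
  | a :: b :: c :: l => by
    rw [wordCap_cons, plateaus, wordCap_eq_plateaus]

theorem plateaus_cons_of_le {a b : ℕ} (l : List ℕ) (h : b ≤ a) :
    plateaus (a :: b :: l) = plateaus (b :: l) := by
  cases l with
  | nil => rfl
  | cons c l => simp [plateaus, Nat.not_lt.2 h]

theorem plateaus_cons_of_ne {a b c : ℕ} (l : List ℕ) (h : b ≠ c) :
    plateaus (a :: b :: c :: l) = plateaus (b :: c :: l) := by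
  simp [plateaus, h]

theorem plateaus_top_cons {m : ℕ} {l : List ℕ} (h : ∀ x ∈ l, x < m) :
    plateaus (m :: l) = plateaus l := by
  cases l with
  | nil => rfl
  | cons b l => exact plateaus_cons_of_le l (h b (by simp)).le

theorem plateaus_insert_after_head {a m : ℕ} {l : List ℕ} (ha : a < m) (h : ∀ x ∈ l, x < m) :
    plateaus (a :: m :: m :: l) = plateaus l + 1 := by
  rw [plateaus, plateaus_cons_of_le _ le_rfl, plateaus_top_cons h]
  simp [ha, add_comm]

theorem two_mul_plateaus_le : ∀ w : List ℕ, 2 * plateaus w ≤ w.length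
  | [] => by simp [plateaus]
  | [_] => by simp [plateaus]
  | [_, _] => by simp [plateaus]
  | a :: b :: c :: l => by
    by_cases h : a < b ∧ b = c
    · have := two_mul_plateaus_le (c :: l)
      rw [plateaus, if_pos h, plateaus_cons_of_le _ h.2.ge]
      simp only [List.length_cons] at *
      omega
    · have := two_mul_plateaus_le (b :: c :: l)
      rw [plateaus, if_neg h]
      simp only [List.length_cons] at *
      omega

theorem length_of_mem_wordInsertions {m : ℕ} {w v : List ℕ} (hv : v ∈ wordInsertions m w) :
    v.length = w.length + 2 := by
  induction w generalizing v with
  | nil => simp [wordInsertions] at hv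
  | cons a l ih =>
    simp only [wordInsertions, List.mem_cons, List.mem_map] at hv
    rcases hv with rfl | ⟨v, hv, rfl⟩
    · simp
    · simp [ih hv]

/-- Inserting two copies of a letter larger than all others next to an ascent plateau keeps the
number of plateaus; any other insertion raises it by one. -/
theorem sum_wordInsertions {R : Type*} [CommRing R] {m : ℕ} :
    ∀ (w : List ℕ) (_ : ∀ x ∈ w, x < m) (F : ℕ → R),
    ((wordInsertions m w).map fun v => F (plateaus v)).sum =
      2 * plateaus w * F (plateaus w) +
        ((w.length : R) - 2 * plateaus w) * F (plateaus w + 1)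
  | [], _, F => by simp [wordInsertions, plateaus]
  | [a], h, F => by
    have ha : a < m := h a (by simp)
    simp [wordInsertions, plateaus, ha]
  | [a, b], h, F => by
    have ha : a < m := h a (by simp)
    have hb : b < m := h b (by simp)
    simp [wordInsertions, plateaus, ha, hb, hb.ne]
    ring
  | a :: b :: c :: l, h, F => by
    have ha : a < m := h a (by simp)
    have hb : b < m := h b (by simp)
    have hl : ∀ x ∈ b :: c :: l, x < m := fun x hx => h x (List.mem_cons_of_mem _ hx)
    have hl' : ∀ x ∈ c :: l, x < m := fun x hx => hl x (List.mem_cons_of_mem _ hx)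
    have hl'' : ∀ x ∈ l, x < m := fun x hx => hl' x (List.mem_cons_of_mem _ hx)
    -- If the word starts with a plateau `a b b`, inserting after `a` or after the first `b` trades
    -- that plateau for a new one. All later insertions keep it, hence the shift of `F` by one in
    -- the induction hypothesis.
    by_cases hab : a < b ∧ b = c
    · obtain ⟨hab, rfl⟩ := hab
      have ih := sum_wordInsertions (b :: l) hl' fun i => F (i + 1)
      have e : ∀ v ∈ wordInsertions m (b :: l), plateaus (a :: b :: v) = plateaus v + 1 := by
        intro v hv
        simp only [wordInsertions, List.mem_cons, List.mem_map] at hv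
        rcases hv with rfl | ⟨v, hv, rfl⟩ <;>
          rw [plateaus, if_pos ⟨hab, rfl⟩, plateaus_cons_of_le _ le_rfl, add_comm]
      rw [wordInsertions, wordInsertions]
      simp only [List.map_cons, List.sum_cons, List.map_map, Function.comp_def]
      rw [List.map_congr_left (fun v hv => by rw [e v hv]), ih,
        plateaus_insert_after_head ha hl, plateaus_cons_of_ne _ hb.ne,
        plateaus_insert_after_head hb hl', plateaus, if_pos ⟨hab, rfl⟩,
        plateaus_cons_of_le _ le_rfl, Nat.add_comm 1]
      push_cast [List.length_cons]
      ring
    -- Without a plateau at the front, inserting after `a` creates one, and later insertions create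
    -- none at the front.
    · have ih := sum_wordInsertions (b :: c :: l) hl F
      have e : ∀ v ∈ wordInsertions m (b :: c :: l), plateaus (a :: v) = plateaus v := by
        intro v hv
        simp only [wordInsertions, List.mem_cons, List.mem_map] at hv
        rcases hv with rfl | ⟨v, rfl | ⟨v, hv, rfl⟩, rfl⟩
        · rw [plateaus_cons_of_ne _ hb.ne]
        all_goals rw [plateaus, if_neg hab, zero_add]
      rw [wordInsertions]
      simp only [List.map_cons, List.sum_cons, List.map_map, Function.comp_def]
      rw [List.map_congr_left (fun v hv => by rw [e v hv]), ih,
        plateaus_insert_after_head ha hl, plateaus, if_neg hab, zero_add]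
      push_cast [List.length_cons]
      ring

/-! ### Cycle weights and the differential operator -/

/-- The weight of a cycle: `X` for a fixed point, and otherwise `X - 1` for every ascent plateau
and `X + 1` for every other pair of entries. -/
noncomputable def cycleWeight (c : List ℕ) : ℤ[X] :=
  if c.length = 2 then X else (X - 1) ^ plateaus c * (X + 1) ^ (c.length / 2 - plateaus c)

/-- The product of the weights of the cycles. -/
noncomputable def weight (σ : List (List ℕ)) : ℤ[X] := (σ.map cycleWeight).prod

theorem plateaus_le_of_length_eq {c : List ℕ} {k : ℕ} (hk : c.length = 2 * k) :
    plateaus c ≤ k := by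
  have := two_mul_plateaus_le c
  omega

/-- Multiplying the derivative of `(X - 1)^p (X + 1)^(k - p)` by `2 (X - 1)(X + 1)` gives `2p` terms
with `p` plateaus and `2k - 2p` with `p + 1`, as in `sum_wordInsertions`. The weight `X` of a fixed
point is chosen so that the same formula holds there: both insertions have weight `X² - 1`. -/
theorem sum_cycleWeight_wordInsertions {m : ℕ} {c : List ℕ} (hc : ∀ x ∈ c, x < m)
    (h0 : c ≠ []) (he : Even c.length) :
    ((wordInsertions m c).map cycleWeight).sum =
      2 * (X ^ 2 - 1) * derivative (cycleWeight c) := by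
  obtain ⟨k, hk⟩ := he
  have hk0 : 0 < k := by
    have := List.length_pos_of_ne_nil h0
    omega
  have e : ∀ v ∈ wordInsertions m c, cycleWeight v =
      (fun i => (X - 1 : ℤ[X]) ^ i * (X + 1) ^ (k + 1 - i)) (plateaus v) := by
    intro v hv
    have := length_of_mem_wordInsertions hv
    rw [cycleWeight, if_neg (by omega), show v.length / 2 = k + 1 by omega]
  rw [List.map_congr_left e,
    sum_wordInsertions c hc fun i => (X - 1 : ℤ[X]) ^ i * (X + 1) ^ (k + 1 - i)]
  have hp := plateaus_le_of_length_eq (hk.trans (two_mul k).symm)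
  by_cases h2 : c.length = 2
  · have hp0 : plateaus c = 0 := by
      match c, h2 with
      | [a, b], _ => rfl
    have : k = 1 := by omega
    subst this
    simp only [hp0, cycleWeight, h2, if_true, derivative_X]
    norm_num
    ring
  · obtain ⟨j, hj⟩ := Nat.exists_eq_add_of_le hp
    rw [cycleWeight, if_neg h2, show c.length / 2 = k by omega]
    generalize plateaus c = p at *
    have hkl : (c.length : ℤ[X]) = 2 * p + 2 * j := by
      rw [hk, hj]; push_cast; ring
    rw [hkl, hj, show p + j + 1 - p = j + 1 by omega, show p + j + 1 - (p + 1) = j by omega,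
      show p + j - p = j by omega]
    -- Multiplying by the base avoids the truncated exponent `p - 1` when `p = 0`.
    have d1 : (X - 1 : ℤ[X]) * derivative ((X - 1 : ℤ[X]) ^ p) = (p : ℤ[X]) * (X - 1) ^ p := by
      cases p with
      | zero => simp
      | succ p => simp [derivative_pow]; ring
    have d2 : (X + 1 : ℤ[X]) * derivative ((X + 1 : ℤ[X]) ^ j) = (j : ℤ[X]) * (X + 1) ^ j := by
      cases j with
      | zero => simp
      | succ p => simp [derivative_pow]; ring
    rw [derivative_mul]
    linear_combination (-2 * (X + 1) * (X + 1 : ℤ[X]) ^ j) * d1 -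
      2 * (X - 1) * (X - 1 : ℤ[X]) ^ p * d2

/-- An insertion changes one factor of the product, which is the product rule; the appended fixed
point contributes the factor `X`. -/
theorem sum_weight_cycleInsertions {m : ℕ} {σ : List (List ℕ)}
    (h : ∀ c ∈ σ, (∀ x ∈ c, x < m) ∧ c ≠ [] ∧ Even c.length) :
    ((cycleInsertions m σ).map weight).sum =
      X * weight σ + 2 * (X ^ 2 - 1) * derivative (weight σ) := by
  induction σ with
  | nil => simp [cycleInsertions, weight, cycleWeight]
  | cons c σ ih =>
    obtain ⟨h1, h2, h3⟩ := h c (by simp)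
    have hw : ∀ (c : List ℕ) (σ), weight (c :: σ) = cycleWeight c * weight σ :=
      fun c σ => by simp [weight]
    have e := sum_cycleWeight_wordInsertions h1 h2 h3
    have ih := ih fun c hc => h c (List.mem_cons_of_mem _ hc)
    simp only [cycleInsertions, List.map_append, List.map_map, List.sum_append, Function.comp_def,
      hw, List.sum_map_mul_left, List.sum_map_mul_right, derivative_mul]
    rw [ih, e]
    ring

/-! ### Standard cycles, described without reduction -/

/-- A cycle in standard form: every entry occurs twice, all entries between two equal ones are
larger, and the first entry is the smallest one. -/
structure IsStandardCycle (c : List ℕ) : Prop where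
  ne_nil : c ≠ []
  count_eq_two : ∀ x ∈ c, c.count x = 2
  lt_of_sublist : ∀ a b, [a, b, a].Sublist c → a < b
  head_le : ∀ x ∈ c, c.headI ≤ x

/-- The rank of `a` among the entries of `w`. -/
def entryRank (w : List ℕ) (a : ℕ) : ℕ := (w.toFinset.filter (· ≤ a)).card

theorem entryRank_lt_entryRank {w : List ℕ} {a b : ℕ} (hb : b ∈ w) (h : a < b) :
    entryRank w a < entryRank w b := by
  refine Finset.card_lt_card (Finset.ssubset_iff_of_subset ?_ |>.2 ⟨b, ?_, ?_⟩)
  · intro x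
    simp only [Finset.mem_filter]
    exact fun hx => ⟨hx.1, hx.2.trans h.le⟩
  · simpa using hb
  · simp [h]

theorem entryRank_lt_entryRank_iff {w : List ℕ} {a b : ℕ} (ha : a ∈ w) (hb : b ∈ w) :
    entryRank w a < entryRank w b ↔ a < b := by
  refine ⟨fun h => ?_, entryRank_lt_entryRank hb⟩
  by_contra hab
  rcases (not_lt.1 hab).eq_or_lt with rfl | hab
  · exact lt_irrefl _ h
  · exact lt_asymm h (entryRank_lt_entryRank ha hab)

theorem entryRank_injOn (w : List ℕ) : Set.InjOn (entryRank w) {x | x ∈ w} := by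
  intro a ha b hb h
  rcases lt_trichotomy a b with hab | hab | hab
  · exact absurd h (entryRank_lt_entryRank hb hab).ne
  · exact hab
  · exact absurd h (entryRank_lt_entryRank ha hab).ne'

theorem red_eq_map (w : List ℕ) : red w = w.map (entryRank w) := rfl

theorem count_doubled (n x : ℕ) :
    (doubled n).count x = if x ∈ Finset.Icc 1 n then 2 else 0 := by
  rw [doubled, Multiset.count_nsmul, Multiset.count_eq_of_nodup (Finset.nodup _)]
  simp only [Finset.mem_val]
  split_ifs <;> rfl

theorem coe_eq_two_nsmul {c : List ℕ} (h : ∀ x ∈ c, c.count x = 2) :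
    (c : Multiset ℕ) = 2 • c.toFinset.val := by
  ext x
  rw [Multiset.count_nsmul, Multiset.count_eq_of_nodup (Finset.nodup _), Multiset.coe_count]
  by_cases hx : x ∈ c
  · simp [hx, h x hx]
  · simp [hx, List.count_eq_zero_of_not_mem hx]

theorem length_eq_two_mul_card {c : List ℕ} (h : ∀ x ∈ c, c.count x = 2) :
    c.length = 2 * c.toFinset.card := by
  have := congrArg Multiset.card (coe_eq_two_nsmul h)
  rwa [Multiset.card_nsmul, Multiset.coe_card] at this

/-- Ranks map the distinct entries injectively into an interval `{1, …, k}` of the same cardinality,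
hence onto it. -/
theorem red_eq_doubled {c : List ℕ} (h : ∀ x ∈ c, c.count x = 2) :
    (red c : Multiset ℕ) = doubled (c.length / 2) := by
  have hl := length_eq_two_mul_card h
  rw [red_eq_map, ← Multiset.map_coe, coe_eq_two_nsmul h, Multiset.map_nsmul, doubled]
  have hinj : Set.InjOn (entryRank c) c.toFinset := by
    simpa using entryRank_injOn c
  rw [← Finset.image_val_of_injOn hinj]
  congr 2
  refine Finset.eq_of_subset_of_card_le ?_ ?_
  · intro y hy
    obtain ⟨x, hx, rfl⟩ := Finset.mem_image.1 hy
    rw [Finset.mem_Icc, hl, Nat.mul_div_cancel_left _ two_pos]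
    exact ⟨Finset.card_pos.2 ⟨x, by simpa using hx⟩, Finset.card_filter_le _ _⟩
  · rw [Finset.card_image_of_injOn hinj, hl]
    simp

theorem sublist_map_entryRank {c : List ℕ} {a b : ℕ} (ha : a ∈ c) (hb : b ∈ c)
    (h : [entryRank c a, entryRank c b, entryRank c a].Sublist (red c)) :
    [a, b, a].Sublist c := by
  obtain ⟨l, hl, e⟩ := List.sublist_map_iff.1 h
  have hm := fun x hx => hl.subset (a := x) hx
  have hlen : l.length = 3 := by simpa using (congrArg List.length e).symm
  match l, hlen with
  | [x, y, z], _ =>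
    simp only [List.map_cons, List.map_nil, List.cons.injEq, and_true] at e
    have hx := entryRank_injOn c ha (hm x (by simp)) e.1
    have hy := entryRank_injOn c hb (hm y (by simp)) e.2.1
    have hz := entryRank_injOn c ha (hm z (by simp)) e.2.2
    subst hx hy hz
    exact hl

/-- Passing to ranks is strictly increasing on the entries of a cycle, so it preserves
multiplicities, patterns `a b a` and order. That both copies of a letter share a cycle is then
automatic, since each entry of a cycle occurs twice in it. -/
theorem isStirlingSecond_iff {n : ℕ} {σ : List (List ℕ)} :
    IsStirlingSecond n σ ↔ (σ.flatten : Multiset ℕ) = doubled n ∧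
      (∀ c ∈ σ, IsStandardCycle c) ∧ σ.Pairwise fun c d => c.headI < d.headI := by
  constructor
  · intro h
    refine ⟨h.entries, fun c hc => ⟨h.cycle_ne_nil c hc, ?_, ?_, h.head_min c hc⟩, h.sorted⟩
    · intro x hx
      have := congrArg (Multiset.count (entryRank c x)) (h.stirling c hc).2.1
      rw [count_doubled, red_eq_map, ← Multiset.map_coe,
        Multiset.count_map_eq_count _ _ (by simpa using entryRank_injOn c) _ (by simpa using hx),
        Multiset.coe_count] at this
      have := List.count_pos_iff.2 hx
      split_ifs at * <;> omega
    · intro a b hab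
      have ha : a ∈ c := hab.subset (by simp)
      have hb : b ∈ c := hab.subset (by simp)
      rw [← entryRank_lt_entryRank_iff ha hb]
      refine (h.stirling c hc).2.2 _ ?_ _ ?_ ?_
      · exact List.mem_map_of_mem ha
      · exact List.mem_map_of_mem hb
      · exact hab.map (entryRank c)
  · rintro ⟨h1, h2, h3⟩
    refine ⟨h1, fun c hc => (h2 c hc).ne_nil, ?_, fun c hc => (h2 c hc).head_le, h3, ?_⟩
    · intro i hi
      have hi' : i ∈ (σ.flatten : Multiset ℕ) := by
        rw [← Multiset.count_pos, h1, count_doubled, if_pos hi]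
        exact two_pos
      obtain ⟨c, hc, hic⟩ := List.mem_flatten.1 (Multiset.mem_coe.1 hi')
      exact ⟨c, hc, (h2 c hc).count_eq_two i hic⟩
    · intro c hc
      have hc2 := (h2 c hc).count_eq_two
      refine ⟨by simp [length_eq_two_mul_card hc2], red_eq_doubled hc2, ?_⟩
      intro a ha b hb hab
      obtain ⟨a, ha', rfl⟩ := List.mem_map.1 ha
      obtain ⟨b, hb', rfl⟩ := List.mem_map.1 hb
      exact entryRank_lt_entryRank hb'
        ((h2 c hc).lt_of_sublist a b (sublist_map_entryRank ha' hb' hab))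

/-! ### Unique generation by inserting the largest letter -/

theorem mem_wordInsertions {m : ℕ} {w v : List ℕ} :
    v ∈ wordInsertions m w ↔ ∃ p q, p ≠ [] ∧ w = p ++ q ∧ v = p ++ m :: m :: q := by
  induction w generalizing v with
  | nil =>
    simp only [wordInsertions, List.not_mem_nil, false_iff]
    rintro ⟨p, q, hp, h, -⟩
    exact hp (List.append_eq_nil_iff.1 h.symm).1
  | cons a l ih =>
    simp only [wordInsertions, List.mem_cons, List.mem_map, ih]
    constructor
    · rintro (rfl | ⟨v, ⟨p, q, hp, rfl, rfl⟩, rfl⟩)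
      · exact ⟨[a], l, by simp, rfl, rfl⟩
      · exact ⟨a :: p, q, by simp, rfl, rfl⟩
    · rintro ⟨p, q, hp, h, rfl⟩
      match p, hp with
      | b :: p, _ =>
        obtain ⟨rfl, rfl⟩ := List.cons.inj h
        by_cases hp : p = []
        · subst hp
          exact Or.inl rfl
        · exact Or.inr ⟨_, ⟨p, q, hp, rfl, rfl⟩, rfl⟩

theorem mem_cycleInsertions {m : ℕ} {σ τ : List (List ℕ)} :
    τ ∈ cycleInsertions m σ ↔ τ = σ ++ [[m, m]] ∨
      ∃ σ₁ c σ₂ c', σ = σ₁ ++ c :: σ₂ ∧ c' ∈ wordInsertions m c ∧ τ = σ₁ ++ c' :: σ₂ := by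
  induction σ generalizing τ with
  | nil => simp [cycleInsertions]
  | cons d σ ih =>
    simp only [cycleInsertions, List.mem_append, List.mem_map, ih]
    constructor
    · rintro (⟨c', hc', rfl⟩ | ⟨τ, rfl | ⟨σ₁, c, σ₂, c', rfl, hc', rfl⟩, rfl⟩)
      · exact Or.inr ⟨[], d, σ, c', rfl, hc', rfl⟩
      · exact Or.inl rfl
      · exact Or.inr ⟨d :: σ₁, c, σ₂, c', rfl, hc', rfl⟩
    · rintro (rfl | ⟨σ₁, c, σ₂, c', h, hc', rfl⟩)
      · exact Or.inr ⟨_, Or.inl rfl, rfl⟩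
      · cases σ₁ with
        | nil =>
          obtain ⟨rfl, rfl⟩ := List.cons.inj h
          exact Or.inl ⟨c', hc', rfl⟩
        | cons e σ₁ =>
          obtain ⟨rfl, rfl⟩ := List.cons.inj h
          exact Or.inr ⟨_, Or.inr ⟨σ₁, c, σ₂, c', rfl, hc', rfl⟩, rfl⟩

theorem filter_ne_of_forall_lt {m : ℕ} {l : List ℕ} (h : ∀ x ∈ l, x < m) :
    l.filter (· ≠ m) = l :=
  List.filter_eq_self.2 fun x hx => by simpa using (h x hx).ne

theorem filter_ne_insert {m : ℕ} {p q : List ℕ} (hp : ∀ x ∈ p, x < m) (hq : ∀ x ∈ q, x < m) :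
    (p ++ m :: m :: q).filter (· ≠ m) = p ++ q := by
  rw [List.filter_append, filter_ne_of_forall_lt hp]
  simpa using fun x hx => (hq x hx).ne

theorem not_sublist_insert {m b : ℕ} {p q : List ℕ} (hp : ∀ x ∈ p, x < m)
    (hq : ∀ x ∈ q, x < m) : ¬ [m, b, m].Sublist (p ++ m :: m :: q) := by
  have hmq : m ∉ q := fun h => lt_irrefl _ (hq m h)
  induction p with
  | nil =>
    intro h
    have h1 : [b, m].Sublist (m :: q) := List.cons_sublist_cons.1 h
    have h2 : [m].Sublist q := by
      rcases List.sublist_cons_iff.1 h1 with h | ⟨r, hr, h⟩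
      · exact (List.sublist_cons_self _ _).trans h
      · obtain ⟨-, rfl⟩ := List.cons.inj hr
        exact h
    exact hmq (h2.subset (by simp))
  | cons a p ih =>
    intro h
    rcases List.sublist_cons_iff.1 h with h | ⟨r, hr, h⟩
    · exact ih (fun x hx => hp x (List.mem_cons_of_mem _ hx)) h
    · exact (hp a (by simp)).ne' (List.cons.inj hr).1

theorem headI_append_eq {p q r : List ℕ} (h : p ≠ []) : (p ++ r).headI = (p ++ q).headI := by
  cases p with
  | nil => exact absurd rfl h
  | cons a p => rfl

theorem headI_mem {c : List ℕ} (h : c ≠ []) : c.headI ∈ c := by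
  cases c with
  | nil => exact absurd rfl h
  | cons a p => simp

/-- Two adjacent copies of a new maximum enclose nothing and are larger than any letters enclosing
them. As `p` is nonempty, the first entry is unchanged. -/
theorem isStandardCycle_insert {m : ℕ} {p q : List ℕ} (h0 : p ≠ []) (hp : ∀ x ∈ p, x < m)
    (hq : ∀ x ∈ q, x < m) : IsStandardCycle (p ++ m :: m :: q) ↔ IsStandardCycle (p ++ q) := by
  have hmp : m ∉ p := fun h => lt_irrefl _ (hp m h)
  have hmq : m ∉ q := fun h => lt_irrefl _ (hq m h)
  have hc : ∀ x, x ≠ m → (p ++ m :: m :: q).count x = (p ++ q).count x := fun x hx => by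
    simp [List.count_append, hx.symm]
  have hh : (p ++ m :: m :: q).headI = (p ++ q).headI := headI_append_eq h0
  have hsub : (p ++ q).Sublist (p ++ m :: m :: q) :=
    (List.Sublist.refl p).append ((List.sublist_cons_self _ _).trans (List.sublist_cons_self _ _))
  have hlt : ∀ x ∈ p ++ q, x < m := fun x hx => (List.mem_append.1 hx).elim (hp x) (hq x)
  have hmem : ∀ x ∈ p ++ m :: m :: q, x = m ∨ x ∈ p ++ q := by
    intro x hx
    simp only [List.mem_append, List.mem_cons] at hx ⊢
    tauto
  constructor
  · intro h
    refine ⟨by simp [h0], ?_, fun a b hab => h.lt_of_sublist a b (hab.trans hsub), ?_⟩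
    · intro x hx
      rw [← hc x (hlt x hx).ne]
      exact h.count_eq_two x (hsub.subset hx)
    · intro x hx
      rw [← hh]
      exact h.head_le x (hsub.subset hx)
  · intro h
    refine ⟨by simp [h0], ?_, ?_, ?_⟩
    · intro x hx
      rcases hmem x hx with rfl | hx
      · simp [List.count_append, List.count_eq_zero_of_not_mem, hmp, hmq]
      · rw [hc x (hlt x hx).ne]
        exact h.count_eq_two x hx
    · intro a b hab
      rcases hmem a (hab.subset (by simp)) with rfl | ha
      · exact absurd hab (not_sublist_insert hp hq)
      · rcases hmem b (hab.subset (by simp)) with rfl | hb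
        · exact hlt a ha
        · refine h.lt_of_sublist a b ?_
          -- Erasing `m` leaves the pattern `a b a` intact and turns the long word into `p ++ q`.
          have := hab.filter (· ≠ m)
          rw [filter_ne_insert hp hq] at this
          simpa [(hlt a ha).ne, (hlt b hb).ne] using this
    · intro x hx
      rw [hh]
      rcases hmem x hx with rfl | hx
      · exact (hlt _ (headI_mem (by simp [h0]))).le
      · exact h.head_le x hx

theorem isStandardCycle_pair (m : ℕ) : IsStandardCycle [m, m] := by
  refine ⟨by simp, by simp, ?_, by simp⟩
  intro a b h
  exact absurd h.length_le (by simp)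

/-- The two copies of the largest entry of a cycle are adjacent. -/
theorem IsStandardCycle.exists_eq_insert {m : ℕ} {c : List ℕ} (h : IsStandardCycle c)
    (hm : m ∈ c) (hle : ∀ x ∈ c, x ≤ m) :
    c = [m, m] ∨ ∃ p q, p ≠ [] ∧ (∀ x ∈ p, x < m) ∧ (∀ x ∈ q, x < m) ∧
      c = p ++ m :: m :: q := by
  obtain ⟨p, r, rfl, hp⟩ := List.eq_append_cons_of_mem hm
  have hcount := h.count_eq_two m hm
  rw [List.count_append, List.count_eq_zero_of_not_mem hp, List.count_cons_self] at hcount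
  have hmr : m ∈ r := List.count_pos_iff.1 (by omega)
  obtain ⟨s, q, rfl, hs⟩ := List.eq_append_cons_of_mem hmr
  have hq : m ∉ q := by
    rw [← List.count_eq_zero]
    rw [List.count_append, List.count_eq_zero_of_not_mem hs, List.count_cons_self] at hcount
    omega
  -- A letter between the two copies of `m` would have to exceed the maximum `m`.
  have hs0 : s = [] := by
    refine List.eq_nil_iff_forall_not_mem.2 fun b hb => ?_
    have hlt : m < b := by
      refine h.lt_of_sublist m b (List.Sublist.trans ?_ (List.sublist_append_right _ _))
      refine List.cons_sublist_cons.2 ?_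
      exact (List.singleton_sublist.2 hb).append (by simp : [m].Sublist (m :: q))
    exact absurd (hle b (by simp [hb])) (not_le.2 hlt)
  subst hs0
  have hlt : ∀ x, x ∈ p ∨ x ∈ q → x < m := by
    intro x hx
    refine lt_of_le_of_ne (hle x ?_) ?_
    · simp; tauto
    · rintro rfl
      tauto
  -- If `m` comes first it is both minimum and maximum, so nothing else remains.
  by_cases hp0 : p = []
  · left
    subst hp0
    have : q = [] := by
      refine List.eq_nil_iff_forall_not_mem.2 fun b hb => ?_
      exact absurd (h.head_le b (by simp [hb])) (not_le.2 (hlt b (Or.inr hb)))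
    simp [this]
  · exact Or.inr ⟨p, q, hp0, fun x hx => hlt x (Or.inl hx), fun x hx => hlt x (Or.inr hx), rfl⟩

theorem doubled_succ (n : ℕ) : doubled (n + 1) = (n + 1) ::ₘ (n + 1) ::ₘ doubled n := by
  ext x
  simp only [Multiset.count_cons, count_doubled, Finset.mem_Icc]
  split_ifs <;> omega

theorem mem_doubled {n x : ℕ} : x ∈ doubled n ↔ 1 ≤ x ∧ x ≤ n := by
  rw [← Multiset.count_pos, count_doubled, ← Finset.mem_Icc]
  split_ifs with h <;> simp only [h, two_pos, lt_irrefl]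

theorem IsStirlingSecond.mem_iff {n : ℕ} {σ : List (List ℕ)} (h : IsStirlingSecond n σ)
    {x : ℕ} : (∃ c ∈ σ, x ∈ c) ↔ 1 ≤ x ∧ x ≤ n := by
  rw [← mem_doubled, ← h.entries, Multiset.mem_coe, List.mem_flatten]

theorem IsStirlingSecond.lt_succ {n : ℕ} {σ : List (List ℕ)} (h : IsStirlingSecond n σ)
    {c : List ℕ} (hc : c ∈ σ) : ∀ x ∈ c, x < n + 1 := fun _ hx =>
  Nat.lt_succ_of_le (h.mem_iff.1 ⟨c, hc, hx⟩).2

theorem flatten_insert {σ₁ σ₂ : List (List ℕ)} {p q : List ℕ} (m : ℕ) :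
    ((σ₁ ++ (p ++ m :: m :: q) :: σ₂).flatten : Multiset ℕ) =
      m ::ₘ m ::ₘ ((σ₁ ++ (p ++ q) :: σ₂).flatten : Multiset ℕ) := by
  ext x
  simp [List.count_append, List.count_cons]
  omega

theorem pairwise_head_congr {σ₁ σ₂ : List (List ℕ)} {c d : List ℕ} (h : c.headI = d.headI) :
    (σ₁ ++ c :: σ₂).Pairwise (fun c d => c.headI < d.headI) ↔
      (σ₁ ++ d :: σ₂).Pairwise (fun c d => c.headI < d.headI) := by
  simp [List.pairwise_append, h]

theorem isStirlingSecond_insert_iff {n : ℕ} {σ₁ σ₂ : List (List ℕ)} {p q : List ℕ} (h0 : p ≠ [])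
    (hp : ∀ x ∈ p, x < n + 1) (hq : ∀ x ∈ q, x < n + 1) :
    IsStirlingSecond (n + 1) (σ₁ ++ (p ++ (n + 1) :: (n + 1) :: q) :: σ₂) ↔
      IsStirlingSecond n (σ₁ ++ (p ++ q) :: σ₂) := by
  simp only [isStirlingSecond_iff]
  rw [flatten_insert, doubled_succ, Multiset.cons_inj_right, Multiset.cons_inj_right,
    pairwise_head_congr (headI_append_eq (q := q) h0)]
  simp only [List.forall_mem_append, List.forall_mem_cons, isStandardCycle_insert h0 hp hq]

theorem isStirlingSecond_append_pair_iff {n : ℕ} {σ : List (List ℕ)} :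
    IsStirlingSecond (n + 1) (σ ++ [[n + 1, n + 1]]) ↔ IsStirlingSecond n σ := by
  have he : ((σ ++ [[n + 1, n + 1]]).flatten : Multiset ℕ) =
      (n + 1) ::ₘ (n + 1) ::ₘ (σ.flatten : Multiset ℕ) := by
    ext x
    simp [List.count_append, List.count_cons]
    omega
  constructor
  · simp only [isStirlingSecond_iff]
    rw [he, doubled_succ, Multiset.cons_inj_right, Multiset.cons_inj_right]
    rintro ⟨h1, h2, h3⟩
    exact ⟨h1, fun c hc => h2 c (List.mem_append_left _ hc), (List.pairwise_append.1 h3).1⟩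
  · intro h
    have hlt := fun c hc => h.lt_succ (c := c) hc
    rw [isStirlingSecond_iff] at h ⊢
    obtain ⟨h1, h2, h3⟩ := h
    refine ⟨by rw [he, h1, doubled_succ], ?_, ?_⟩
    · exact List.forall_mem_append.2 ⟨h2, by simpa using isStandardCycle_pair (n + 1)⟩
    · refine List.pairwise_append.2 ⟨h3, by simp, ?_⟩
      intro c hc d hd
      obtain rfl := List.mem_singleton.1 hd
      exact hlt c hc _ (headI_mem (h2 c hc).ne_nil)

theorem IsStirlingSecond.of_mem_cycleInsertions {n : ℕ} {σ τ : List (List ℕ)}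
    (h : IsStirlingSecond n σ) (hτ : τ ∈ cycleInsertions (n + 1) σ) :
    IsStirlingSecond (n + 1) τ := by
  rcases mem_cycleInsertions.1 hτ with rfl | ⟨σ₁, c, σ₂, c', rfl, hc, rfl⟩
  · exact isStirlingSecond_append_pair_iff.2 h
  · obtain ⟨p, q, hp, rfl, rfl⟩ := mem_wordInsertions.1 hc
    have hlt := h.lt_succ (c := p ++ q) (by simp)
    exact (isStirlingSecond_insert_iff hp (fun x hx => hlt x (by simp [hx]))
      (fun x hx => hlt x (by simp [hx]))).2 h

/-- The two copies of `n + 1` are adjacent and can be deleted. If they form a whole cycle, the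
ordering by first entries forces that cycle to be last. -/
theorem IsStirlingSecond.exists_mem_cycleInsertions {n : ℕ} {τ : List (List ℕ)}
    (h : IsStirlingSecond (n + 1) τ) :
    ∃ σ, IsStirlingSecond n σ ∧ τ ∈ cycleInsertions (n + 1) σ := by
  have hcyc := (isStirlingSecond_iff.1 h).2.1
  obtain ⟨c, hc, hm⟩ := (h.mem_iff (x := n + 1)).2 ⟨by omega, le_rfl⟩
  have hle : ∀ d ∈ τ, ∀ x ∈ d, x ≤ n + 1 := fun d hd x hx => (h.mem_iff.1 ⟨d, hd, hx⟩).2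
  obtain ⟨τ₁, τ₂, rfl⟩ := List.append_of_mem hc
  rcases (hcyc c hc).exists_eq_insert hm (hle c hc) with rfl | ⟨p, q, h0, hp, hq, rfl⟩
  · have : τ₂ = [] := by
      refine List.eq_nil_iff_forall_not_mem.2 fun d hd => ?_
      have h1 := (List.pairwise_cons.1 (List.pairwise_append.1 h.sorted).2.1).1 d hd
      have hd' : d ∈ τ₁ ++ [n + 1, n + 1] :: τ₂ := by simp [hd]
      exact absurd (hle d hd' _ (headI_mem (hcyc d hd').ne_nil)) (not_le.2 h1)
    subst this
    exact ⟨τ₁, isStirlingSecond_append_pair_iff.1 h, mem_cycleInsertions.2 (Or.inl rfl)⟩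
  · exact ⟨_, (isStirlingSecond_insert_iff h0 hp hq).1 h, mem_cycleInsertions.2
      (Or.inr ⟨τ₁, _, τ₂, _, rfl, mem_wordInsertions.2 ⟨p, q, h0, rfl, rfl⟩, rfl⟩)⟩

/-- Delete the letter `m` from all cycles, and then all empty cycles. -/
def deleteLetter (m : ℕ) (σ : List (List ℕ)) : List (List ℕ) :=
  (σ.map fun c => c.filter (· ≠ m)).filter (· ≠ [])

theorem deleteLetter_eq_self {m : ℕ} {σ : List (List ℕ)}
    (h : ∀ c ∈ σ, (∀ x ∈ c, x < m) ∧ c ≠ []) : deleteLetter m σ = σ := by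
  rw [deleteLetter, List.map_congr_left fun c hc => filter_ne_of_forall_lt (h c hc).1,
    List.map_id', List.filter_eq_self]
  simpa using fun c hc => (h c hc).2

/-- Deletion undoes insertion, so different `σ` have disjoint sets of insertions. -/
theorem deleteLetter_of_mem_cycleInsertions {m : ℕ} {σ τ : List (List ℕ)}
    (h : ∀ c ∈ σ, (∀ x ∈ c, x < m) ∧ c ≠ []) (hτ : τ ∈ cycleInsertions m σ) :
    deleteLetter m τ = σ := by
  rcases mem_cycleInsertions.1 hτ with rfl | ⟨σ₁, c, σ₂, c', rfl, hc, rfl⟩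
  · have := deleteLetter_eq_self h
    simp only [deleteLetter, List.map_append, List.filter_append] at *
    rw [this]
    simp
  · obtain ⟨p, q, hp, rfl, rfl⟩ := mem_wordInsertions.1 hc
    have hlt := (h (p ++ q) (by simp)).1
    rw [← deleteLetter_eq_self h, deleteLetter, deleteLetter]
    simp only [List.map_append, List.map_cons]
    rw [filter_ne_insert (fun x hx => hlt x (by simp [hx])) (fun x hx => hlt x (by simp [hx])),
      filter_ne_of_forall_lt hlt]

theorem nodup_wordInsertions {m : ℕ} {w : List ℕ} (h : ∀ x ∈ w, x < m) :
    (wordInsertions m w).Nodup := by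
  induction w with
  | nil => simp [wordInsertions]
  | cons a l ih =>
    have hl : ∀ x ∈ l, x < m := fun x hx => h x (List.mem_cons_of_mem _ hx)
    refine List.nodup_cons.2 ⟨?_, (ih hl).map (List.cons_injective)⟩
    intro hmem
    obtain ⟨v, hv, e⟩ := List.mem_map.1 hmem
    obtain ⟨p, q, hp, rfl, rfl⟩ := mem_wordInsertions.1 hv
    -- Equality would make the second letter both `m` and a letter of `l`, which is smaller than
    -- `m`.
    match p, hp with
    | b :: p, _ =>
      simp only [List.cons_append, List.cons.injEq] at e
      exact (hl b (by simp)).ne e.2.1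

theorem nodup_cycleInsertions {m : ℕ} {σ : List (List ℕ)} (h : ∀ c ∈ σ, ∀ x ∈ c, x < m) :
    (cycleInsertions m σ).Nodup := by
  induction σ with
  | nil => simp [cycleInsertions]
  | cons c σ ih =>
    refine List.Nodup.append ?_ ?_ ?_
    · exact (nodup_wordInsertions (h c (by simp))).map fun _ _ e => (List.cons.inj e).1
    · exact (ih fun c hc => h c (List.mem_cons_of_mem _ hc)).map List.cons_injective
    · intro τ h1 h2
      obtain ⟨v, hv, rfl⟩ := List.mem_map.1 h1
      obtain ⟨τ, -, e⟩ := List.mem_map.1 h2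
      obtain ⟨rfl, -⟩ := List.cons.inj e
      -- The first cycle would have both its old length and that length plus two.
      have := length_of_mem_wordInsertions hv
      omega

theorem isStirlingSecond_zero_iff {σ : List (List ℕ)} : IsStirlingSecond 0 σ ↔ σ = [] := by
  rw [isStirlingSecond_iff]
  constructor
  · rintro ⟨h1, h2, -⟩
    refine List.eq_nil_iff_forall_not_mem.2 fun c hc => (h2 c hc).ne_nil ?_
    have : σ.flatten = [] := by simpa [doubled] using h1
    exact List.flatten_eq_nil_iff.1 this c hc
  · rintro rfl
    simp [doubled]

/-! ### The weight enumerator and its value at zero -/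

/-- The Stirling permutations of the second kind of order `n`. -/
def stirlingSecond : ℕ → Finset (List (List ℕ))
  | 0 => {[]}
  | n + 1 => (stirlingSecond n).biUnion fun σ => (cycleInsertions (n + 1) σ).toFinset

theorem mem_stirlingSecond {n : ℕ} {σ : List (List ℕ)} :
    σ ∈ stirlingSecond n ↔ IsStirlingSecond n σ := by
  induction n generalizing σ with
  | zero => rw [stirlingSecond, Finset.mem_singleton, isStirlingSecond_zero_iff]
  | succ n ih =>
    simp only [stirlingSecond, Finset.mem_biUnion, List.mem_toFinset, ih]
    exact ⟨fun ⟨_, h, hσ⟩ => h.of_mem_cycleInsertions hσ, fun h => h.exists_mem_cycleInsertions⟩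

/-- The weight enumerator of the Stirling permutations of the second kind of order `n`. -/
noncomputable def weightPoly (n : ℕ) : ℤ[X] := ∑ σ ∈ stirlingSecond n, weight σ

theorem weightPoly_zero : weightPoly 0 = 1 := by
  simp [weightPoly, stirlingSecond, weight]

theorem weightPoly_succ (n : ℕ) :
    weightPoly (n + 1) = X * weightPoly n + 2 * (X ^ 2 - 1) * derivative (weightPoly n) := by
  have hσ : ∀ σ ∈ stirlingSecond n,
      ∀ c ∈ σ, (∀ x ∈ c, x < n + 1) ∧ c ≠ [] ∧ Even c.length := by
    intro σ hσ c hc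
    have h := mem_stirlingSecond.1 hσ
    exact ⟨h.lt_succ hc, h.cycle_ne_nil c hc, (h.stirling c hc).1⟩
  rw [weightPoly, stirlingSecond, Finset.sum_biUnion, weightPoly, derivative_sum, Finset.mul_sum,
    Finset.mul_sum, ← Finset.sum_add_distrib]
  · refine Finset.sum_congr rfl fun σ h => ?_
    rw [← sum_weight_cycleInsertions (hσ σ h),
      List.sum_toFinset _ (nodup_cycleInsertions fun c hc => (hσ σ h c hc).1)]
  · intro σ h τ h' hne
    refine Finset.disjoint_left.2 fun ρ h1 h2 => hne ?_
    rw [← deleteLetter_of_mem_cycleInsertions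
        (fun c hc => ⟨(hσ σ h c hc).1, (hσ σ h c hc).2.1⟩) (List.mem_toFinset.1 h1),
      deleteLetter_of_mem_cycleInsertions
        (fun c hc => ⟨(hσ τ h' c hc).1, (hσ τ h' c hc).2.1⟩) (List.mem_toFinset.1 h2)]

theorem eval_zero_weight (σ : List (List ℕ)) :
    (weight σ).eval 0 = if ∃ c ∈ σ, c.length = 2 then 0 else (-1) ^ cap σ := by
  induction σ with
  | nil => simp [weight, cap]
  | cons c σ ih =>
    have h1 : weight (c :: σ) = cycleWeight c * weight σ := by simp [weight]
    have h2 : cap (c :: σ) = plateaus c + cap σ := by simp [cap, wordCap_eq_plateaus]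
    rw [h1, h2, eval_mul, ih, cycleWeight]
    by_cases hc : c.length = 2
    · simp [hc]
    · simp [hc, pow_add]

theorem isStirlingDerangement_iff {n : ℕ} {σ : List (List ℕ)} :
    IsStirlingDerangement n σ ↔ IsStirlingSecond n σ ∧ ¬ ∃ c ∈ σ, c.length = 2 := by
  refine and_congr_right fun h => ⟨?_, ?_⟩
  · rintro h' ⟨c, hc, hl⟩
    match c, hl with
    | [a, b], _ =>
      have h2 := ((isStirlingSecond_iff.1 h).2.1 _ hc).count_eq_two a (by simp)
      -- A two-letter cycle is a fixed point because `a` must occur twice in it.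
      have hab : b = a := by
        by_contra hne
        simp [hne] at h2
      subst hab
      exact h' b (Finset.mem_Icc.2 (h.mem_iff.1 ⟨_, hc, by simp⟩)) hc
  · intro h' k _ hk
    exact h' ⟨_, hk, rfl⟩

theorem sum_stirlingDerangements (n : ℕ) :
    ∑ σ ∈ stirlingDerangements n, (-1 : ℤ) ^ cap σ = (weightPoly n).eval 0 := by
  classical
  rw [weightPoly, eval_finsetSum]
  simp only [eval_zero_weight]
  have : stirlingDerangements n =
      (stirlingSecond n).filter fun σ => ¬ ∃ c ∈ σ, c.length = 2 := by
    ext σ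
    rw [stirlingDerangements, Set.Finite.mem_toFinset, Set.mem_ofPred_eq,
      isStirlingDerangement_iff, Finset.mem_filter, mem_stirlingSecond]
  rw [this, Finset.sum_filter]
  refine Finset.sum_congr rfl fun σ _ => ?_
  split_ifs <;> rfl

/-! ### Derivatives and Taylor coefficients of the square root of the secant -/

open Filter Topology in
-- The value at `0` is `1`, so near `0` the secant avoids the branch cut and the principal root is
-- differentiable.
theorem eventually_sec_mem_slitPlane :
    ∀ᶠ z in 𝓝 (0 : ℂ), Complex.sec (2 * Complex.I * z) ∈ Complex.slitPlane := by
  have hc : ContinuousAt (fun z : ℂ => Complex.sec (2 * Complex.I * z)) 0 := by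
    unfold Complex.sec
    refine ContinuousAt.div continuousAt_const ?_ (by simp)
    exact (Complex.continuous_cos.comp (continuous_const.mul continuous_id)).continuousAt
  refine hc.eventually_mem (Complex.isOpen_slitPlane.mem_nhds ?_)
  simp [Complex.sec]

theorem cos_ne_zero_of_sec_mem_slitPlane {z : ℂ} (h : Complex.sec z ∈ Complex.slitPlane) :
    Complex.cos z ≠ 0 := by
  intro h0
  exact Complex.slitPlane_ne_zero h (by simp [Complex.sec, h0])

theorem hasDerivAt_sqrt_sec {z : ℂ}
    (h : Complex.sec (2 * Complex.I * z) ∈ Complex.slitPlane) :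
    HasDerivAt (fun z => Complex.sqrt (Complex.sec (2 * Complex.I * z)))
      (Complex.I * Complex.tan (2 * Complex.I * z) *
        Complex.sqrt (Complex.sec (2 * Complex.I * z))) z := by
  have hne := cos_ne_zero_of_sec_mem_slitPlane h
  have h1 : HasDerivAt (fun z : ℂ => 2 * Complex.I * z) (2 * Complex.I) z := by
    simpa using (hasDerivAt_id z).const_mul (2 * Complex.I)
  have h2 := ((h1.ccos.fun_inv hne).cpow_const (c := 2⁻¹)
    (by simpa [Complex.sec] using h))
  simp only [Complex.sqrt, Complex.sec, one_div]
  refine h2.congr_deriv ?_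
  rw [Complex.cpow_sub _ _ (inv_ne_zero hne), Complex.cpow_one, Complex.tan]
  field_simp

theorem hasDerivAt_I_mul_tan {z : ℂ} (h : Complex.cos (2 * Complex.I * z) ≠ 0) :
    HasDerivAt (fun z => Complex.I * Complex.tan (2 * Complex.I * z))
      (2 * ((Complex.I * Complex.tan (2 * Complex.I * z)) ^ 2 - 1)) z := by
  have h1 : HasDerivAt (fun z : ℂ => 2 * Complex.I * z) (2 * Complex.I) z := by
    simpa using (hasDerivAt_id z).const_mul (2 * Complex.I)
  refine (((Complex.hasDerivAt_tan h).comp z h1).const_mul Complex.I).congr_deriv ?_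
  have := Complex.sin_sq_add_cos_sq (2 * Complex.I * z)
  rw [Complex.tan]
  generalize Complex.sin (2 * Complex.I * z) = s at *
  generalize Complex.cos (2 * Complex.I * z) = c at *
  field_simp
  linear_combination (1 - s ^ 2) * Complex.I_sq + this

open Filter Topology in
-- Differentiating `P_n(T) f` with `T' = 2 (T² - 1)` and `f' = T f` reproduces the recurrence for
-- `P_n`. The identity is needed on a neighbourhood, not only at `0`, so that it can be
-- differentiated again.
theorem iteratedDeriv_sqrt_sec (n : ℕ) :
    ∀ᶠ z in 𝓝 (0 : ℂ),
      iteratedDeriv n (fun z => Complex.sqrt (Complex.sec (2 * Complex.I * z))) z =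
        aeval (Complex.I * Complex.tan (2 * Complex.I * z)) (weightPoly n) *
          Complex.sqrt (Complex.sec (2 * Complex.I * z)) := by
  induction n with
  | zero => simp [weightPoly_zero]
  | succ n ih =>
    filter_upwards [eventually_eventually_nhds.2 ih, eventually_sec_mem_slitPlane] with z hz hs
    have hne := cos_ne_zero_of_sec_mem_slitPlane hs
    rw [iteratedDeriv_succ, EventuallyEq.deriv_eq hz]
    have h1 := ((weightPoly n).hasDerivAt_aeval
      (Complex.I * Complex.tan (2 * Complex.I * z))).comp z (hasDerivAt_I_mul_tan hne)
    have h2 := h1.fun_mul (hasDerivAt_sqrt_sec hs)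
    refine h2.deriv.trans ?_
    rw [weightPoly_succ]
    simp only [map_add, map_mul, aeval_X, map_sub, map_pow, map_one, map_ofNat, Function.comp_apply]
    ring

theorem analyticAt_sqrt_sec :
    AnalyticAt ℂ (fun z => Complex.sqrt (Complex.sec (2 * Complex.I * z))) 0 :=
  Complex.analyticAt_iff_eventually_differentiableAt.2
    (eventually_sec_mem_slitPlane.mono fun _ h => (hasDerivAt_sqrt_sec h).differentiableAt)

theorem iteratedDeriv_sqrt_sec_zero (n : ℕ) :
    iteratedDeriv n (fun z => Complex.sqrt (Complex.sec (2 * Complex.I * z))) 0 =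
      ((weightPoly n).eval 0 : ℤ) := by
  rw [(iteratedDeriv_sqrt_sec n).self_of_nhds]
  simp [Complex.sec, aeval_def, eval₂_eq_eval_map, ← coeff_zero_eq_eval_zero]

/-- Both multiplication by `X` and `(X² - 1) d/dX` reverse parity. -/
theorem weightPoly_comp_neg (n : ℕ) : (weightPoly n).comp (-X) = (-1) ^ n * weightPoly n := by
  induction n with
  | zero => simp [weightPoly_zero]
  | succ n ih =>
    have hd := congrArg derivative ih
    rw [derivative_comp, show ((-1 : ℤ[X]) ^ n) = C ((-1) ^ n) by simp, derivative_C_mul] at hd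
    simp only [derivative_X, map_pow, map_neg, map_one] at hd
    rw [weightPoly_succ]
    simp only [add_comp, mul_comp, X_comp, sub_comp, pow_comp, one_comp, ofNat_comp]
    rw [ih]
    linear_combination -2 * (X ^ 2 - 1) * hd

theorem eval_zero_weightPoly_of_odd {n : ℕ} (hn : Odd n) : (weightPoly n).eval 0 = 0 := by
  have := congrArg (eval 0) (weightPoly_comp_neg n)
  simp [hn.neg_one_pow, eval_comp] at this
  omega

/-- Uniqueness of power series turns the expansion into equality of coefficients with the Taylor
series. Padding the even series with zeros at odd indices, as in `b`, is consistent because `P_n(0)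
= 0` for odd `n`. -/
theorem isSqrtSecCoeff_iff {h : ℕ → ℂ} :
    IsSqrtSecCoeff h ↔ ∀ k, (-1) ^ k * h k = ((weightPoly (2 * k)).eval 0 : ℤ) := by
  set b : ℕ → ℂ := fun n => if Even n then (-1) ^ (n / 2) * h (n / 2) / (n.factorial : ℂ) else 0
    with hb
  have hinj : Function.Injective fun n : ℕ => 2 * n := fun _ _ e => by simpa using e
  have h1 : IsSqrtSecCoeff h ↔
      HasFPowerSeriesAt (fun z => Complex.sqrt (Complex.sec (2 * Complex.I * z)))
        (FormalMultilinearSeries.ofScalars ℂ b) 0 := by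
    rw [hasFPowerSeriesAt_iff, IsSqrtSecCoeff]
    refine Filter.eventually_congr (Filter.Eventually.of_forall fun z => ?_)
    rw [← hinj.hasSum_iff
      (f := fun n => z ^ n • (FormalMultilinearSeries.ofScalars ℂ b).coeff n), zero_add]
    · refine iff_of_eq (congrArg (HasSum · _) (funext fun n => ?_))
      simp [hb, FormalMultilinearSeries.coeff_ofScalars]
      ring
    · intro n hn
      have : ¬ Even n := fun he => hn ⟨n / 2, Nat.two_mul_div_two_of_even he⟩
      simp [hb, FormalMultilinearSeries.coeff_ofScalars, this]
  have h2 := analyticAt_sqrt_sec.hasFPowerSeriesAt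
  simp only [iteratedDeriv_sqrt_sec_zero] at h2
  rw [h1]
  constructor
  · intro h3 k
    have := congrArg (fun p => FormalMultilinearSeries.coeff p (2 * k))
      (h3.eq_formalMultilinearSeries h2)
    simp only [FormalMultilinearSeries.coeff_ofScalars, hb, even_two_mul, if_true,
      Nat.mul_div_cancel_left k two_pos] at this
    exact (div_left_inj' (Nat.cast_ne_zero.2 (Nat.factorial_ne_zero _))).1 this
  · intro h3
    convert! h2 using 1
    congr 1
    funext n
    rcases Nat.even_or_odd n with he | ho
    · obtain ⟨k, rfl⟩ := he.two_dvd
      simp [hb, h3]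
    · simp [hb, Nat.not_even_iff_odd.2 ho, eval_zero_weightPoly_of_odd ho]

theorem mainTheorem12 :
    (∃! h : ℕ → ℂ, IsSqrtSecCoeff h) ∧
    ∀ h : ℕ → ℂ, IsSqrtSecCoeff h → ∀ n : ℕ, 1 ≤ n →
      (Odd n → ∑ σ ∈ stirlingDerangements n, (-1 : ℂ) ^ cap σ = 0) ∧
      (∀ k : ℕ, n = 2 * k →
        ∑ σ ∈ stirlingDerangements n, (-1 : ℂ) ^ cap σ = (-1) ^ k * h k) := by
  have hsum : ∀ n, ∑ σ ∈ stirlingDerangements n, (-1 : ℂ) ^ cap σ =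
      ((weightPoly n).eval 0 : ℤ) := fun n => by
    rw [← sum_stirlingDerangements]
    push_cast
    rfl
  have hsq : ∀ k : ℕ, (-1 : ℂ) ^ k * (-1) ^ k = 1 := fun k => by
    rw [← mul_pow]
    simp
  -- Since `(-1)^k` is its own inverse, `isSqrtSecCoeff_iff` can be solved for `h k`, giving
  -- existence and uniqueness.
  refine ⟨⟨fun k => (-1) ^ k * ((weightPoly (2 * k)).eval 0 : ℤ), ?_, ?_⟩, ?_⟩
  · refine isSqrtSecCoeff_iff.2 fun k => ?_
    rw [← mul_assoc, hsq, one_mul]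
  · intro h hh
    funext k
    rw [← isSqrtSecCoeff_iff.1 hh k, ← mul_assoc, hsq, one_mul]
  · intro h hh n _
    refine ⟨fun ho => ?_, ?_⟩
    · rw [hsum, eval_zero_weightPoly_of_odd ho, Int.cast_zero]
    · rintro k rfl
      rw [hsum, isSqrtSecCoeff_iff.1 hh k]
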